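/- Write $\omega=\{0,1,2,\dots\}$. A tree is a set $T\subseteq\omega^{<\omega}$ closed under initial segments, and $[T]=\{x\in\omega^\omega:\forall n\ (x|_n\in T)\}$. A node of $T$ is splitting ($\omega$-splitting) if it has at least two (infinitely many) immediate successors in $T$. Consider the following six forcing notions $\mathbb P$; each condition $p\in\mathbb P$ has a body $[p]\subseteq\omega^\omega$. (1) Sacks forcing $\mathbb S$: non-empty trees $T\subseteq 2^{<\omega}$ in which every node has an extension in $T$ that is splitting, ordered by inclusion. (2) Miller forcing $\mathbb M$: non-empty trees $T\subseteq\omega^{<\omega}$ in which every splitting node is $\omega$-splitting and every node has an extension in $T$ that is splitting, ordered by inclusion. (3) Matet forcing $\mathbb T$: pairs $\langle s,A\rangle$ where $s$ is a finite strictly increasing sequence from $\omega$ (possibly empty) and $A=\{a_1,a_2,\dots\}$ is an infinite set of non-empty finite strictly increasing sequences such that, with $a_0=s$, every value of $a_i$ is less than every value of $a_{i+1}$ for all $i\ge 0$. Put $\langle s,A\rangle\le\langle t,B\rangle$ iff $s$ extends $t$, every $a\in A$ is a concatenation of finitely many elements of $B$, and $\mathrm{ran}(s)\setminus\mathrm{ran}(t)$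 is the range of a concatenation of finitely many (possibly zero) elements of $B$. The body $[\langle s,A\rangle]$ is the set of all $x=s^\frown c_1{}^\frown c_2{}^\frown\cdots$ with $c_1,c_2,\dots\in A$ such that every value of $c_i$ is less than every value of $c_{i+1}$ for all $i\ge1$. (4) Prikry–Silver forcing $\mathbb V$: those $T\in\mathbb S$ such that for all $t_1,t_2\in T$ of the same length and $i\in\{0,1\}$, $t_1{}^\frown\langle i\rangle\in T\iff t_2{}^\frown\langle i\rangle\in T$; ordered by inclusion. (5) Willowtree forcing $\mathbb W$: pairs $W=\langle f,A\rangle$ where $A$ is an infinite set of pairwise disjoint non-empty finite subsets of $\omega$ and $f:\omega\setminus\bigcup A\to 2$. Let $T_W$ be the tree of all $s\in2^{<\omega}$ such that $s(n)=f(n)$ for all $n<|s|$ with $n\in\mathrm{dom}(f)$ and such that, for each $a\in A$, $s$ is constant on $\{n\in a:n<|s|\}$. Put $W\le W'$ iff $T_W\subseteq T_{W'}$. (6) Laver forcing $\mathbb L$: trees $T\subseteq\omega^{<\omega}$ having a node $s\in T$ (the stem) such that every node of $T$ is comparable with $s$ and every node $t\in T$ extending $s$ (including $t=s$) is $\omega$-splitting;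 ordered by inclusion. For the forcing notions consisting of trees, the body of $T$ is $[T]$, and for a willowtree $W$ it is $[T_W]$. A set $A\subseteq\omega^\omega$ is called $\mathbb P$-measurable if for every $p\in\mathbb P$ there is $p'\le p$ in $\mathbb P$ with $[p']\cap A=\emptyset$ or $[p']\cap(\omega^\omega\setminus A)=\emptyset$. Theorem. For each $\mathbb P\in\{\mathbb S,\mathbb M,\mathbb T,\mathbb V,\mathbb W,\mathbb L\}$, every analytic subset of $\omega^\omega$ is $\mathbb P$-measurable. -/

import Mathlib

namespace TreeForcing

/-- The initial segment `x|ₙ = ⟨x 0, …, x (n - 1)⟩` of a real `x ∈ ω^ω`. -/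
def initSeg (x : ℕ → ℕ) (n : ℕ) : List ℕ := (List.range n).map x

/-- The set `[T]` of all branches of a tree `T ⊆ ω^{<ω}`. -/
def branches (T : Descriptive.tree ℕ) : Set (ℕ → ℕ) := {x | ∀ n, initSeg x n ∈ T}

/-- The set of all `n` such that `t ⌢ ⟨n⟩` is an immediate successor of `t` in `T`. -/
def succ (T : Descriptive.tree ℕ) (t : List ℕ) : Set ℕ := {n | t ++ [n] ∈ T}

/-- `t` is a splitting node of `T`: it has more than one immediate successor. -/
def IsSplitting (T : Descriptive.tree ℕ) (t : List ℕ) : Prop := t ∈ T ∧ (succ T t).Nontrivial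

/-- `t` is an `ω`-splitting node of `T`: it has infinitely many immediate successors. -/
def IsOmegaSplitting (T : Descriptive.tree ℕ) (t : List ℕ) : Prop := t ∈ T ∧ (succ T t).Infinite

/-- The tree is contained in `2^{<ω}`. -/
def IsBinary (T : Descriptive.tree ℕ) : Prop := ∀ t ∈ T, ∀ n ∈ t, n < 2

/-- A set `A` of reals is measurable for the forcing notion `P`, whose conditions `p` have the
bodies `[p] = body p`: below every condition there is one whose body is disjoint from `A` or
disjoint from the complement of `A`. -/
def IsMeasurableFor (P : Type) [Preorder P] (body : P → Set (ℕ → ℕ)) (A : Set (ℕ → ℕ)) : Prop :=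
  ∀ p : P, ∃ p' ≤ p, body p' ∩ A = ∅ ∨ body p' ∩ Aᶜ = ∅

/-! ### Laver, Miller, Sacks and Prikry–Silver forcing

These are sets of non-empty trees, ordered by inclusion. -/

/-- Laver trees: there is a (necessarily unique) finite stem `s`, that is a node comparable with
all nodes, and all nodes from `s` on are `ω`-splitting. -/
def IsLaver (T : Descriptive.tree ℕ) : Prop :=
  ∃ s ∈ T, (∀ t ∈ T, t <+: s ∨ s <+: t) ∧ ∀ t ∈ T, s <+: t → IsOmegaSplitting T t

/-- Superperfect trees: non-empty, every splitting node is `ω`-splitting, and every node has a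
splitting node above it. -/
def IsSuperperfect (T : Descriptive.tree ℕ) : Prop :=
  [] ∈ T ∧ (∀ t ∈ T, IsSplitting T t → IsOmegaSplitting T t) ∧
    ∀ t ∈ T, ∃ u, t <+: u ∧ IsSplitting T u

/-- Perfect trees: non-empty subtrees of `2^{<ω}` with a splitting node above every node. -/
def IsPerfect (T : Descriptive.tree ℕ) : Prop :=
  [] ∈ T ∧ IsBinary T ∧ ∀ t ∈ T, ∃ u, t <+: u ∧ IsSplitting T u

/-- Uniform perfect trees: nodes of the same length have the same immediate successors. -/
def IsUniformPerfect (T : Descriptive.tree ℕ) : Prop :=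
  IsPerfect T ∧ ∀ t₁ ∈ T, ∀ t₂ ∈ T, t₁.length = t₂.length →
    (t₁ ++ [0] ∈ T ↔ t₂ ++ [0] ∈ T) ∧ (t₁ ++ [1] ∈ T ↔ t₂ ++ [1] ∈ T)

/-- Laver forcing. -/
abbrev Laver : Type := {T : Descriptive.tree ℕ // IsLaver T}

/-- Miller forcing. -/
abbrev Miller : Type := {T : Descriptive.tree ℕ // IsSuperperfect T}

/-- Sacks forcing. -/
abbrev Sacks : Type := {T : Descriptive.tree ℕ // IsPerfect T}

/-- Prikry–Silver forcing. -/
abbrev PrikrySilver : Type := {T : Descriptive.tree ℕ // IsUniformPerfect T}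

/-! ### Matet forcing -/

/-- Matet conditions `⟨s, A⟩`: `s` is a finite strictly increasing sequence (possibly empty) and
`A` is an infinite set of non-empty finite strictly increasing sequences, such that for an
enumeration `a₀ = s`, `A = {a₁, a₂, …}` all values of `aᵢ` are smaller than all values
of `aᵢ₊₁`. -/
structure Matet : Type where
  stem : List ℕ
  blocks : Set (List ℕ)
  exists_enum : ∃ a : ℕ → List ℕ, a 0 = stem ∧ blocks = Set.range (fun i => a (i + 1)) ∧
    (∀ i, (a i).Pairwise (· < ·)) ∧ (∀ i, a (i + 1) ≠ []) ∧
    ∀ i, ∀ m ∈ a i, ∀ n ∈ a (i + 1), m < n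

namespace Matet

/-- `⟨s, A⟩ ≤ ⟨t, B⟩`: `s` extends `t`, every `a ∈ A` is a concatenation of elements of `B`, and
`ran s \ ran t` is the range of a concatenation of (possibly zero) elements of `B`. -/
instance : LE Matet where
  le p q := q.stem <+: p.stem ∧
    (∀ a ∈ p.blocks, ∃ bs : List (List ℕ), (∀ b ∈ bs, b ∈ q.blocks) ∧ a = bs.flatten) ∧
    ∃ βs : List (List ℕ), (∀ β ∈ βs, β ∈ q.blocks) ∧
      p.stem.toFinset \ q.stem.toFinset = βs.flatten.toFinset

theorem le_def (p q : Matet) : p ≤ q ↔ q.stem <+: p.stem ∧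
    (∀ a ∈ p.blocks, ∃ bs : List (List ℕ), (∀ b ∈ bs, b ∈ q.blocks) ∧ a = bs.flatten) ∧
    ∃ βs : List (List ℕ), (∀ β ∈ βs, β ∈ q.blocks) ∧
      p.stem.toFinset \ q.stem.toFinset = βs.flatten.toFinset := Iff.rfl

theorem exists_flatten {A B : Set (List ℕ)}
    (h : ∀ a ∈ A, ∃ bs : List (List ℕ), (∀ b ∈ bs, b ∈ B) ∧ a = bs.flatten)
    (as : List (List ℕ)) (has : ∀ a ∈ as, a ∈ A) :
    ∃ bs : List (List ℕ), (∀ b ∈ bs, b ∈ B) ∧ as.flatten = bs.flatten := by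
  induction as with
  | nil => exact ⟨[], by simp, rfl⟩
  | cons a as ih =>
    obtain ⟨bs, hbs, e⟩ := h a (has a (by simp))
    obtain ⟨cs, hcs, e'⟩ := ih (fun x hx => has x (by simp [hx]))
    refine ⟨bs ++ cs, ?_, by simp [e, e']⟩
    intro b hb
    rcases List.mem_append.1 hb with hb | hb
    exacts [hbs b hb, hcs b hb]

instance : Preorder Matet where
  le_refl p := ⟨List.prefix_rfl, fun a ha => ⟨[a], by simpa using ha, by simp⟩, [], by simp, by simp⟩
  le_trans p q r hpq hqr := by
    obtain ⟨h1, h2, βs, h3, h4⟩ := hpq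
    obtain ⟨k1, k2, γs, k3, k4⟩ := hqr
    refine ⟨k1.trans h1, fun a ha => ?_, ?_⟩
    · obtain ⟨bs, hbs, rfl⟩ := h2 a ha
      exact exists_flatten k2 bs hbs
    · obtain ⟨δs, hδ, e⟩ := exists_flatten k2 βs h3
      refine ⟨γs ++ δs, ?_, ?_⟩
      · intro b hb
        rcases List.mem_append.1 hb with hb | hb
        exacts [k3 b hb, hδ b hb]
      · rw [List.flatten_append, List.toFinset_append, ← e, ← h4, ← k4]
        have i1 : ∀ n, n ∈ r.stem → n ∈ q.stem := fun n hn => k1.subset hn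
        have i2 : ∀ n, n ∈ q.stem → n ∈ p.stem := fun n hn => h1.subset hn
        ext n
        simp only [Finset.mem_sdiff, Finset.mem_union, List.mem_toFinset]
        have := i1 n
        have := i2 n
        tauto

/-- The body `[s, A]`: all reals `x = s ⌢ c₁ ⌢ c₂ ⌢ …` where `c₁, c₂, …` is the increasing
enumeration of an infinite subset of `A`. -/
def body (p : Matet) : Set (ℕ → ℕ) :=
  {x | ∃ c : ℕ → List ℕ, (∀ i, c i ∈ p.blocks) ∧ (∀ i, ∀ m ∈ c i, ∀ n ∈ c (i + 1), m < n) ∧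
    ∀ k, ∃ n, initSeg x n = p.stem ++ ((List.range k).map c).flatten}

end Matet

/-! ### Willowtree forcing -/

/-- Willowtrees `⟨f, A⟩`: `A` is an infinite set of pairwise disjoint non-empty finite subsets
of `ω` and `f` is a function from `ω \ ⋃ A` to `2`. -/
structure Willowtree : Type where
  blocks : Set (Finset ℕ)
  infinite : blocks.Infinite
  nonempty : ∀ a ∈ blocks, a.Nonempty
  disjoint : ∀ a ∈ blocks, ∀ b ∈ blocks, a ≠ b → Disjoint a b
  f : {n : ℕ // ∀ a ∈ blocks, n ∉ a} → Fin 2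

namespace Willowtree

/-- The tree of all `s ∈ 2^{<ω}` that agree with `f` on its domain and are constant on every
`a ∈ A` (as far as they are defined). -/
def tree (W : Willowtree) : Descriptive.tree ℕ where
  val := {s | (∀ n ∈ s, n < 2) ∧
    (∀ (n : ℕ) (hn : n < s.length) (hf : ∀ a ∈ W.blocks, n ∉ a), s[n] = (W.f ⟨n, hf⟩ : ℕ)) ∧
    ∀ a ∈ W.blocks, ∀ m ∈ a, ∀ n ∈ a, ∀ (hm : m < s.length) (hn : n < s.length), s[m] = s[n]}
  property := by
    rintro s k ⟨h1, h2, h3⟩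
    refine ⟨fun n hn => h1 n (by simp [hn]), fun n hn hf => ?_, fun a ha m hm n hn hm' hn' => ?_⟩
    · have := h2 n (by simp; omega) hf
      rwa [List.getElem_append_left hn] at this
    · have := h3 a ha m hm n hn (by simp; omega) (by simp; omega)
      rwa [List.getElem_append_left hm', List.getElem_append_left hn'] at this

/-- Willowtrees are ordered by inclusion of their trees. -/
instance : Preorder Willowtree := Preorder.lift tree

end Willowtree

end TreeForcing

namespace TreeForcing

/-! All six cases rest on one Ramsey theorem of Silver, `exists_homogeneous`: for an analytic `A`
and an Ellentuck-continuous map `g` from infinite subsets of ω to reals, some infinite `H` has all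
its infinite subsets sent into `A`, or all sent outside `A`.

To prove it, write `A` as the range of a continuous `f` and let `S u` be the `g`-preimage of the
`f`-image of the cone of `u`. Ramsey null sets form a σ-ideal, and open sets are completely Ramsey.
Hence, outside a null set, a point in the closure of `S u` lies in the closure of some `S (u ++
[n])`. Iterating gives an `x` whose initial segments all have the point `Z` in the closure of their
`S`, and continuity forces `f x = g Z`.

Each forcing condition is then coded by a finitary map on sequences, chosen so that restricting the
codes to a homogeneous family yields a smaller condition whose body consists of images of
homogeneous codes. Increasing sequences of naturals serve Matet, Miller and Laver forcing
(`exists_homogeneous_strictMono`). Binary sequences that are frozen off an infinite set serve Sacks,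
Prikry–Silver and willowtree forcing (`exists_homogeneous_doughnut`). -/

open Set

/-! ### Ellentuck topology, fusion, and open sets -/

/-- An infinite subset of `ω`. -/
structure InfSet : Type where
  carrier : Set ℕ
  infinite : carrier.Infinite

/-- The Ellentuck topology on `[ω]^ω`. -/
instance : TopologicalSpace InfSet where
  IsOpen U := ∀ Z ∈ U, ∃ n, ∀ Z' : InfSet, Z'.carrier ⊆ Z.carrier →
    (∀ k < n, k ∈ Z.carrier → k ∈ Z'.carrier) → Z' ∈ U
  isOpen_univ := fun _ _ => ⟨0, fun _ _ _ => trivial⟩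
  isOpen_inter := fun U V hU hV Z hZ => by
    obtain ⟨n, hn⟩ := hU Z hZ.1
    obtain ⟨m, hm⟩ := hV Z hZ.2
    exact ⟨max n m, fun Z' h h' =>
      ⟨hn Z' h fun k hk => h' k (hk.trans_le (le_max_left _ _)),
        hm Z' h fun k hk => h' k (hk.trans_le (le_max_right _ _))⟩⟩
  isOpen_sUnion := fun S hS Z ⟨U, hU, hZ⟩ => by
    obtain ⟨n, hn⟩ := hS U hU Z hZ
    exact ⟨n, fun Z' h h' => ⟨U, hU, hn Z' h h'⟩⟩

theorem InfSet.isOpen_iff {U : Set InfSet} : IsOpen U ↔ ∀ Z ∈ U, ∃ n, ∀ Z' : InfSet,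
    Z'.carrier ⊆ Z.carrier → (∀ k < n, k ∈ Z.carrier → k ∈ Z'.carrier) → Z' ∈ U := Iff.rfl

/-- The basic Ellentuck set `[a, X]`: all infinite sets with initial segment `a` whose other
elements belong to `X`. -/
def basic (a : Finset ℕ) (X : Set ℕ) : Set InfSet :=
  {Z | ↑a ⊆ Z.carrier ∧ ∀ n ∈ Z.carrier, n ∈ a ∨ (n ∈ X ∧ ∀ m ∈ a, m < n)}

theorem basic_mono {a : Finset ℕ} {X Y : Set ℕ} (h : ∀ n ∈ X, (∀ m ∈ a, m < n) → n ∈ Y) :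
    basic a X ⊆ basic a Y := fun _ hZ =>
  ⟨hZ.1, fun n hn => (hZ.2 n hn).imp id fun h' => ⟨h n h'.1 h'.2, h'.2⟩⟩

theorem infinite_tail {X : Set ℕ} (hX : X.Infinite) (a : Finset ℕ) :
    {n ∈ X | ∀ m ∈ a, m < n}.Infinite := by
  refine (hX.sdiff (finite_le_nat (a.sup id))).mono fun n hn => ⟨hn.1, fun m hm => ?_⟩
  have h1 : m ≤ a.sup id := Finset.le_sup (f := id) hm
  have h2 : ¬ n ≤ a.sup id := hn.2
  omega

theorem isOpen_basic (a : Finset ℕ) (X : Set ℕ) : IsOpen (basic a X) := by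
  refine InfSet.isOpen_iff.2 fun Z hZ => ⟨a.sup id + 1, fun Z' h h' => ⟨fun k hk => ?_, fun n hn =>
    hZ.2 n (h hn)⟩⟩
  have h1 : k ≤ a.sup id := Finset.le_sup (f := id) hk
  exact h' k (by omega) (hZ.1 hk)

/-- Diagonalization: since `D b Y` depends only on the part of `Y` above `b`, one treats the
finitely many `b` below each new element in turn, and the set of successive minima works for all its
finite subsets at once. -/
theorem exists_fusion (D : Finset ℕ → Set ℕ → Prop)
    (mono : ∀ b Y Y', D b Y → (∀ n ∈ Y', (∀ m ∈ b, m < n) → n ∈ Y) → D b Y')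
    (dense : ∀ b X, X.Infinite → ∃ Y ⊆ X, Y.Infinite ∧ D b Y) {X : Set ℕ} (hX : X.Infinite) :
    ∃ Y ⊆ X, Y.Infinite ∧ ∀ b : Finset ℕ, ↑b ⊆ Y → D b Y := by
  have finset : ∀ (s : Finset (Finset ℕ)) (X : Set ℕ), X.Infinite →
      ∃ Y ⊆ X, Y.Infinite ∧ ∀ b ∈ s, D b Y := by
    intro s
    induction s using Finset.induction_on with
    | empty => exact fun X hX => ⟨X, subset_rfl, hX, by simp⟩
    | insert b s _ ih =>
      intro X hX
      obtain ⟨Y, hYX, hY, hD⟩ := ih X hX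
      obtain ⟨Y', hY'Y, hY', hD'⟩ := dense b Y hY
      refine ⟨Y', hY'Y.trans hYX, hY', fun c hc => ?_⟩
      rcases Finset.mem_insert.1 hc with rfl | hc
      · exact hD'
      · exact mono c Y Y' (hD c hc) fun n hn _ => hY'Y hn
  have step : ∀ (m : ℕ) (X : InfSet), ∃ Y : InfSet, Y.carrier ⊆ X.carrier ∧
      (∀ n ∈ Y.carrier, m ≤ n) ∧ ∀ b ⊆ Finset.range m, D b Y.carrier := by
    intro m X
    obtain ⟨Y, hYX, hY, hD⟩ := finset (Finset.range m).powerset _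
      (infinite_tail X.infinite (Finset.range m))
    refine ⟨⟨Y, hY⟩, fun n hn => (hYX hn).1, fun n hn => ?_, fun b hb =>
      hD b (Finset.mem_powerset.2 hb)⟩
    by_contra hlt
    exact lt_irrefl n ((hYX hn).2 n (Finset.mem_range.2 (not_le.1 hlt)))
  choose g hgX hgm hgD using step
  -- Each set is shrunk above its own minimum so as to satisfy `D b` for every `b` bounded by that
  -- minimum.
  let S : ℕ → InfSet := fun k => Nat.rec (g 0 ⟨X, hX⟩) (fun _ Y => g (sInf Y.carrier + 1) Y) k
  have hS : ∀ k, S (k + 1) = g (sInf (S k).carrier + 1) (S k) := fun _ => rfl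
  let y : ℕ → ℕ := fun k => sInf (S k).carrier
  have hyS : ∀ k, y k ∈ (S k).carrier := fun k => Nat.sInf_mem (S k).infinite.nonempty
  have hanti : Antitone fun k => (S k).carrier := antitone_nat_of_succ_le fun k => by
    rw [hS]; exact hgX _ _
  have hy : StrictMono y := strictMono_nat_of_lt_succ fun k =>
    hgm (y k + 1) (S k) _ (by rw [← hS]; exact hyS (k + 1))
  refine ⟨range y, ?_, infinite_range_of_injective hy.injective, fun b hb => ?_⟩
  · rintro _ ⟨k, rfl⟩
    exact hgX 0 ⟨X, hX⟩ (hanti (Nat.zero_le k) (hyS k))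
  · rcases b.eq_empty_or_nonempty with rfl | hne
    · refine mono _ _ _ (hgD 0 ⟨X, hX⟩ ∅ (by simp)) ?_
      rintro _ ⟨k, rfl⟩ -
      exact hanti (Nat.zero_le k) (hyS k)
    · obtain ⟨k, hk⟩ := hb (b.max'_mem hne)
      refine mono _ _ _ (hgD (y k + 1) (S k) b fun n hn => Finset.mem_range.2 ?_) ?_
      · have := b.le_max' n hn
        omega
      · rintro _ ⟨j, rfl⟩ hj
        have hkj : k < j := hy.lt_iff_lt.1 (hk ▸ hj _ (b.max'_mem hne))
        rw [← hS]
        exact hanti hkj (hyS j)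

theorem exists_initial {a : Finset ℕ} {Y : Set ℕ} {Z : InfSet} (hZ : Z ∈ basic a Y) (n : ℕ) :
    ∃ b : Finset ℕ, ↑b ⊆ Y ∧ n ≤ b.sup id ∧ Z ∈ basic (a ∪ b) Y ∧
      ∀ k < n, k ∈ Z.carrier → k ∈ a ∪ b := by
  obtain ⟨N, ⟨hNZ, hNa⟩, hN⟩ := (infinite_tail Z.infinite a).exists_gt n
  have hna : N ∉ a := fun h => lt_irrefl _ (hNa N h)
  classical
  let b : Finset ℕ := (Finset.range (N + 1)).filter fun k => k ∈ Z.carrier ∧ k ∉ a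
  have hb : ∀ k, k ∈ b ↔ k ≤ N ∧ k ∈ Z.carrier ∧ k ∉ a := fun k => by
    simp [b]
  have hab : ∀ k ∈ Z.carrier, k ≤ N → k ∈ a ∪ b := fun k hk hkN => by
    by_cases h : k ∈ a
    · exact Finset.mem_union_left _ h
    · exact Finset.mem_union_right _ ((hb k).2 ⟨hkN, hk, h⟩)
  refine ⟨b, fun k hk => ?_, ?_, ⟨fun k hk => ?_, fun k hk => ?_⟩,
    fun k hk hkZ => hab k hkZ (by omega)⟩
  · obtain ⟨-, hkZ, hka⟩ := (hb k).1 hk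
    exact ((hZ.2 k hkZ).resolve_left hka).1
  · exact hN.le.trans (Finset.le_sup (f := id) ((hb N).2 ⟨le_rfl, hNZ, hna⟩))
  · rcases Finset.mem_union.1 (Finset.mem_coe.1 hk) with h | h
    · exact hZ.1 h
    · exact ((hb k).1 h).2.1
  · rcases le_or_gt k N with h | h
    · exact Or.inl (hab k hk h)
    · have hka : k ∉ a := fun h' => by have := hNa k h'; omega
      refine Or.inr ⟨((hZ.2 k hk).resolve_left hka).1, fun m hm => ?_⟩
      rcases Finset.mem_union.1 hm with h' | h'
      · exact (hNa m h').trans h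
      · exact (((hb m).1 h').1).trans_lt h

/-- Ellentuck-open sets are completely Ramsey. -/
theorem exists_basic_subset_or_disjoint {U : Set InfSet} (hU : IsOpen U) (a : Finset ℕ)
    {X : Set ℕ} (hX : X.Infinite) :
    ∃ Y ⊆ X, Y.Infinite ∧ (basic a Y ⊆ U ∨ Disjoint (basic a Y) U) := by
  -- The Galvin–Prikry acceptance and rejection argument: a first fusion makes `Y₀` decide all its
  -- finite subsets, a second makes rejection pass to end-extensions by one element.
  let Acc : Finset ℕ → Set ℕ → Prop := fun b Y => basic (a ∪ b) Y ⊆ U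
  let Rej : Finset ℕ → Set ℕ → Prop := fun b Y => ∀ Y' ⊆ Y, Y'.Infinite → ¬ Acc b Y'
  obtain ⟨Y₀, hY₀X, hY₀, hdec⟩ := exists_fusion (fun b Y => Acc b Y ∨ Rej b Y)
    (fun b Y Y' h hsub => by
      refine h.imp (fun h => (basic_mono fun n hn hm => hsub n hn fun m hmb =>
        hm m (Finset.mem_union_right _ hmb)).trans h) fun h Y'' hY'' hinf hacc => ?_
      refine h {n ∈ Y'' | ∀ m ∈ b, m < n} (fun n hn => hsub n (hY'' hn.1) hn.2)
        (infinite_tail hinf b) ((basic_mono fun n hn _ => hn.1).trans hacc))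
    (fun b X hX => by
      by_cases h : ∃ Y ⊆ X, Y.Infinite ∧ Acc b Y
      · obtain ⟨Y, h1, h2, h3⟩ := h
        exact ⟨Y, h1, h2, Or.inl h3⟩
      · push Not at h
        exact ⟨X, subset_rfl, hX, Or.inr h⟩)
    (infinite_tail hX a)
  rcases hdec ∅ (by simp) with hacc | hrej
  · exact ⟨Y₀, fun n hn => (hY₀X hn).1, hY₀, Or.inl (by simpa [Acc] using hacc)⟩
  obtain ⟨Y, hYY₀, hY, hD⟩ := exists_fusion
    (fun b Y => ↑b ⊆ Y₀ → Rej b Y₀ → ∀ n ∈ Y, n ∈ Y₀ → (∀ m ∈ b, m < n) → Rej (insert n b) Y₀)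
    (fun b Y Y' h hsub hb hr n hn hn₀ hm => h hb hr n (hsub n hn hm) hn₀ hm)
    (fun b X hX => by
      by_cases hb : ↑b ⊆ Y₀ ∧ Rej b Y₀
      swap
      · exact ⟨X, subset_rfl, hX, fun h1 h2 => (hb ⟨h1, h2⟩).elim⟩
      obtain ⟨hb, hr⟩ := hb
      -- Were `E` infinite, it would accept `b`: a set in `basic (a ∪ b) E` is captured by the
      -- accepted extension of `b` by its least new element. So only finitely many points have to be
      -- removed.
      let E : Set ℕ := {n ∈ Y₀ | (∀ m ∈ b, m < n) ∧ Acc (insert n b) Y₀}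
      have hE : E.Finite := by
        by_contra hE
        refine hr E (fun n hn => hn.1) hE fun Z hZ => ?_
        obtain ⟨hn, hmin⟩ : _ ∧ _ := ⟨Nat.sInf_mem (Z.infinite.sdiff (a ∪ b).finite_toSet).nonempty,
          fun k hk => Nat.sInf_le (s := Z.carrier \ ↑(a ∪ b)) hk⟩
        set n := sInf (Z.carrier \ ↑(a ∪ b))
        obtain ⟨hnE, hnab⟩ := (hZ.2 n hn.1).resolve_left hn.2
        refine hnE.2.2 ⟨?_, fun k hk => ?_⟩
        · intro k hk
          have hk' : k = n ∨ k ∈ a ∪ b := by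
            simpa [or_left_comm] using hk
          rcases hk' with rfl | hk'
          · exact hn.1
          · exact hZ.1 hk'
        · by_cases hkab : k ∈ a ∪ b
          · left
            rcases Finset.mem_union.1 hkab with h | h <;> simp [h]
          · obtain ⟨hkE, hlt⟩ := (hZ.2 k hk).resolve_left hkab
            rcases (hmin k ⟨hk, hkab⟩).eq_or_lt with h | h
            · left; simp [← h]
            · right
              refine ⟨hkE.1, fun m hm => ?_⟩
              have hm' : m = n ∨ m ∈ a ∪ b := by
                simpa [or_left_comm] using hm
              rcases hm' with rfl | hm'
              exacts [h, hlt m hm']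
      refine ⟨X \ E, sdiff_subset, hX.sdiff hE, fun _ _ n hn hn₀ hlt => ?_⟩
      refine (hdec (insert n b) ?_).resolve_left fun h => hn.2 ⟨hn₀, hlt, h⟩
      rw [Finset.coe_insert]
      exact insert_subset hn₀ hb)
    hY₀
  have hall : ∀ b : Finset ℕ, ↑b ⊆ Y → Rej b Y₀ := by
    intro b
    induction b using Finset.induction_on_max with
    | empty => exact fun _ => hrej
    | insert n b hlt ih =>
      intro hb
      rw [Finset.coe_insert, insert_subset_iff] at hb
      exact hD b hb.2 (hb.2.trans hYY₀) (ih hb.2) n hb.1 (hYY₀ hb.1) hlt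
  -- A point `Z` of `U` would have an initial segment `b` accepted by the rest of `Z`, against the
  -- rejection of every finite subset of `Y`.
  refine ⟨Y, fun n hn => (hY₀X (hYY₀ hn)).1, hY, Or.inr (disjoint_left.2 fun Z hZ hZU => ?_)⟩
  obtain ⟨n, hn⟩ := InfSet.isOpen_iff.1 hU Z hZU
  obtain ⟨b, hbY, -, hZb, hin⟩ := exists_initial hZ n
  refine hall b hbY (Z.carrier \ ↑(a ∪ b)) (fun k hk => hYY₀ ((hZb.2 k hk.1).resolve_left hk.2).1)
    (Z.infinite.sdiff (a ∪ b).finite_toSet) fun Z' hZ' => hn Z' (fun k hk => ?_) fun k hk hkZ =>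
      hZ'.1 (hin k hk hkZ)
  rcases hZ'.2 k hk with h | h
  exacts [hZb.1 h, h.1.1]

/-! ### The σ-ideal of Ramsey null sets -/

/-- Ramsey null sets. -/
def RamseyNull (N : Set InfSet) : Prop :=
  ∀ (a : Finset ℕ) (X : Set ℕ), X.Infinite → ∃ Y ⊆ X, Y.Infinite ∧ Disjoint (basic a Y) N

/-- Fusion where `b` takes care of the finitely many `N k` with `k ≤ max b`; a given `Z` has initial
segments with arbitrarily large maximum, so it avoids every `N k`. -/
theorem RamseyNull.iUnion {N : ℕ → Set InfSet} (hN : ∀ k, RamseyNull (N k)) :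
    RamseyNull (⋃ k, N k) := by
  intro a X hX
  obtain ⟨Y, hYX, hY, hD⟩ := exists_fusion
    (fun b Y => ∀ k ≤ b.sup id, Disjoint (basic (a ∪ b) Y) (N k))
    (fun b Y Y' h hsub k hk => (h k hk).mono_left (basic_mono fun n hn hm => hsub n hn fun m hmb =>
        hm m (Finset.mem_union_right _ hmb)))
    (fun b X hX => by
      generalize b.sup id = j
      induction j with
      | zero =>
        obtain ⟨Y, h1, h2, h3⟩ := hN 0 (a ∪ b) X hX
        exact ⟨Y, h1, h2, fun k hk => by rwa [Nat.le_zero.1 hk]⟩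
      | succ j ih =>
        obtain ⟨Y, h1, h2, h3⟩ := ih
        obtain ⟨Y', h1', h2', h3'⟩ := hN (j + 1) (a ∪ b) Y h2
        refine ⟨Y', h1'.trans h1, h2', fun k hk => ?_⟩
        rcases Nat.le_succ_iff.1 hk with hk | rfl
        · exact (h3 k hk).mono_left (basic_mono fun n hn _ => h1' hn)
        · exact h3')
    hX
  refine ⟨Y, hYX, hY, disjoint_left.2 fun Z hZ hZN => ?_⟩
  obtain ⟨k, hk⟩ := mem_iUnion.1 hZN
  obtain ⟨b, hbY, hkb, hZb, -⟩ := exists_initial hZ k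
  exact disjoint_left.1 (hD b hbY k hkb) hZb hk

theorem ramseyNull_sdiff_interior {F : Set InfSet} (hF : IsClosed F) :
    RamseyNull (F \ interior F) := by
  intro a X hX
  obtain ⟨Y, hYX, hY, h⟩ := exists_basic_subset_or_disjoint hF.isOpen_compl a hX
  rcases h with h | h
  · exact ⟨Y, hYX, hY, disjoint_left.2 fun Z hZ hZF => h hZ hZF.1⟩
  · refine ⟨Y, hYX, hY, disjoint_left.2 fun Z hZ hZF => hZF.2 ?_⟩
    exact interior_maximal (disjoint_compl_right_iff_subset.1 h) (isOpen_basic a Y) hZ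

/-- Avoid all the null boundaries of the `closure (S n)`, then decide the union of their interiors.
A basic set missing that union meets no `S n`, and being open it misses the closure of their union
too. -/
theorem ramseyNull_closure_iUnion_sdiff (S : ℕ → Set InfSet) :
    RamseyNull (closure (⋃ n, S n) \ ⋃ n, closure (S n)) := by
  intro a X hX
  obtain ⟨Y, hYX, hY, h⟩ := RamseyNull.iUnion
    (fun n => ramseyNull_sdiff_interior (isClosed_closure (s := S n))) a X hX
  obtain ⟨Y', hY'Y, hY', h'⟩ := exists_basic_subset_or_disjoint
    (isOpen_iUnion fun n => isOpen_interior (s := closure (S n))) a hY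
  refine ⟨Y', hY'Y.trans hYX, hY', ?_⟩
  rcases h' with h' | h'
  · exact disjoint_left.2 fun Z hZ hZ' =>
      hZ'.2 (iUnion_mono (fun n => interior_subset) (h' hZ))
  · refine Disjoint.mono_right sdiff_subset
      (Disjoint.closure_right ?_ (isOpen_basic a Y'))
    refine disjoint_left.2 fun Z hZ hZS => ?_
    obtain ⟨n, hn⟩ := mem_iUnion.1 hZS
    refine disjoint_left.1 h (basic_mono (fun k hk _ => hY'Y hk) hZ) (mem_iUnion.2 ⟨n,
      subset_closure hn, fun hi => disjoint_left.1 h' hZ (mem_iUnion.2 ⟨n, hi⟩)⟩)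

/-! ### Initial segments and Silver's theorem -/

@[simp] theorem length_initSeg (x : ℕ → ℕ) (n : ℕ) : (initSeg x n).length = n := by
  simp [initSeg]

theorem initSeg_succ (x : ℕ → ℕ) (n : ℕ) : initSeg x (n + 1) = initSeg x n ++ [x n] := by
  simp [initSeg, List.range_succ]

theorem initSeg_eq_initSeg {x y : ℕ → ℕ} {n : ℕ} :
    initSeg x n = initSeg y n ↔ ∀ i < n, x i = y i := by
  simp [initSeg, List.map_inj_left]

theorem exists_path (v : List ℕ → ℕ) : ∃ x : ℕ → ℕ, ∀ n, x n = v (initSeg x n) := by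
  let U : ℕ → List ℕ := fun n => Nat.rec [] (fun _ u => u ++ [v u]) n
  have hU : ∀ n, U (n + 1) = U n ++ [v (U n)] := fun _ => rfl
  have hx : ∀ n, initSeg (fun k => v (U k)) n = U n := by
    intro n
    induction n with
    | zero => rfl
    | succ n ih => rw [initSeg_succ, ih, hU]
  exact ⟨fun k => v (U k), fun n => by rw [hx]⟩

theorem exists_forall_initSeg (P : List ℕ → Prop) (h0 : P [])
    (h : ∀ u, P u → ∃ n, P (u ++ [n])) : ∃ x : ℕ → ℕ, ∀ n, P (initSeg x n) := by
  have h' : ∀ u, ∃ n, P u → P (u ++ [n]) := fun u => by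
    by_cases hu : P u
    · obtain ⟨n, hn⟩ := h u hu
      exact ⟨n, fun _ => hn⟩
    · exact ⟨0, fun h => (hu h).elim⟩
  choose v hv using h'
  obtain ⟨x, hx⟩ := exists_path v
  refine ⟨x, fun n => ?_⟩
  induction n with
  | zero => exact h0
  | succ n ih =>
    rw [initSeg_succ, hx n]
    exact hv _ ih

/-- Silver's theorem: continuous preimages of analytic sets are Ramsey. -/
theorem exists_homogeneous {g : InfSet → ℕ → ℕ} (hg : Continuous g) {A : Set (ℕ → ℕ)}
    (hA : MeasureTheory.AnalyticSet A) : ∃ H : Set ℕ, H.Infinite ∧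
      ((∀ Z : InfSet, Z.carrier ⊆ H → g Z ∈ A) ∨ ∀ Z : InfSet, Z.carrier ⊆ H → g Z ∉ A) := by
  rw [MeasureTheory.AnalyticSet] at hA
  rcases hA with rfl | ⟨f, hf, rfl⟩
  · exact ⟨univ, infinite_univ, Or.inr fun _ _ => by simp⟩
  let C : List ℕ → Set (ℕ → ℕ) := fun u => {x | initSeg x u.length = u}
  let S : List ℕ → Set InfSet := fun u => g ⁻¹' (f '' C u)
  have hS : ∀ u, S u = ⋃ n, S (u ++ [n]) := fun u => by
    have : C u = ⋃ n, C (u ++ [n]) := by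
      ext x
      simp [C, initSeg_succ]
    simp only [S]
    rw [this, image_iUnion, preimage_iUnion]
  let e := Denumerable.eqv (List ℕ)
  obtain ⟨Y, -, hY, hN⟩ := RamseyNull.iUnion (fun k =>
    ramseyNull_closure_iUnion_sdiff fun n => S (e.symm k ++ [n])) ∅ univ infinite_univ
  obtain ⟨Y', hY'Y, hY', h⟩ := exists_basic_subset_or_disjoint
    (isClosed_closure (s := S [])).isOpen_compl ∅ hY
  have hmem : ∀ {V : Set ℕ} {Z : InfSet}, Z.carrier ⊆ V → Z ∈ basic ∅ V := fun h =>
    ⟨by simp, fun n hn => Or.inr ⟨h hn, by simp⟩⟩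
  refine ⟨Y', hY', ?_⟩
  rcases h with h | h
  · refine Or.inr fun Z hZ hgZ => h (hmem hZ) (subset_closure ?_)
    obtain ⟨x, hx⟩ := hgZ
    exact ⟨x, by simp [C, initSeg], hx⟩
  · refine Or.inl fun Z hZ => ?_
    -- A node `u` where no extension works would put `Z` into the null set avoided by `Y`.
    obtain ⟨x, hx⟩ := exists_forall_initSeg (fun u => Z ∈ closure (S u))
      (not_not.1 fun h' => disjoint_left.1 h (hmem hZ) h') fun u hu => by
        by_contra hcon
        push Not at hcon
        refine disjoint_left.1 hN (hmem (hZ.trans hY'Y)) (mem_iUnion.2 ⟨e u, ?_⟩)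
        rw [e.symm_apply_apply, ← hS]
        exact ⟨hu, by simpa using hcon⟩
    refine ⟨x, ?_⟩
    -- If `f x` and `g Z` differ at `k`, both values at `k` are locally constant; a point of `S
    -- (initSeg x n)` near `Z` then has two different values there.
    by_contra hne
    obtain ⟨k, hk⟩ := Function.ne_iff.1 hne
    have hopen : IsOpen {y : ℕ → ℕ | f y k = f x k} :=
      (isOpen_discrete {f x k}).preimage ((continuous_apply k).comp hf)
    obtain ⟨n, hn⟩ : ∃ n, C (initSeg x n) ⊆ {y : ℕ → ℕ | f y k = f x k} := by
      obtain ⟨_, ⟨y, n, rfl⟩, hxy, hsub⟩ :=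
        (PiNat.isTopologicalBasis_cylinders (fun _ : ℕ => ℕ)).exists_subset_of_mem_open
          (show x ∈ {y : ℕ → ℕ | f y k = f x k} from rfl) hopen
      refine ⟨n, fun z hz => hsub ?_⟩
      simp only [C, length_initSeg, mem_ofPred_eq, initSeg_eq_initSeg] at hz
      exact fun i hi => (hz i hi).trans (hxy i hi)
    have hopen' : IsOpen {W : InfSet | g W k = g Z k} :=
      (isOpen_discrete {g Z k}).preimage ((continuous_apply k).comp hg)
    obtain ⟨W, hW, y, hy, hyW⟩ := mem_closure_iff.1 (hx n) _ hopen' rfl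
    have h1 : f y k = f x k := hn hy
    have h2 : g W k = g Z k := hW
    exact hk (by rw [← h1, ← h2, hyW])

/-! ### Homogeneity for finitary codings -/

/-- Every value of `g x` is determined by a fixed number of values of `x`. -/
def Finitary (g : (ℕ → ℕ) → ℕ → ℕ) : Prop :=
  ∀ k, ∃ m, ∀ x y : ℕ → ℕ, (∀ i < m, x i = y i) → g x k = g y k

theorem Finitary.continuous {g : (ℕ → ℕ) → ℕ → ℕ} (hg : Finitary g) : Continuous g := by
  refine continuous_pi fun k => ⟨fun s _ => ?_⟩
  obtain ⟨m, hm⟩ := hg k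
  refine (PiNat.isTopologicalBasis_cylinders (fun _ : ℕ => ℕ)).isOpen_iff.2 fun x hx =>
    ⟨_, ⟨x, m, rfl⟩, PiNat.self_mem_cylinder x m, fun y hy => ?_⟩
  rw [mem_preimage, hm y x hy]
  exact hx

theorem InfSet.continuous_iff {e : InfSet → ℕ → ℕ} :
    Continuous e ↔ ∀ Z k, ∃ n, ∀ Z' : InfSet, Z'.carrier ⊆ Z.carrier →
      (∀ i < n, i ∈ Z.carrier → i ∈ Z'.carrier) → e Z' k = e Z k := by
  refine ⟨fun h Z k => ?_, fun h => continuous_pi fun k => ?_⟩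
  · exact InfSet.isOpen_iff.1
      ((isOpen_discrete {e Z k}).preimage ((continuous_apply k).comp h)) Z rfl
  · refine ⟨fun s _ => InfSet.isOpen_iff.2 fun Z hZ => ?_⟩
    obtain ⟨n, hn⟩ := h Z k
    refine ⟨n, fun Z' h1 h2 => ?_⟩
    rw [mem_preimage, hn Z' h1 h2]
    exact hZ

theorem nth_eq_of_agree {Z Z' : InfSet} {n i : ℕ} (h1 : Z'.carrier ⊆ Z.carrier)
    (h2 : ∀ i < n, i ∈ Z.carrier → i ∈ Z'.carrier) (hi : Nat.nth (· ∈ Z.carrier) i < n) :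
    Nat.nth (· ∈ Z'.carrier) i = Nat.nth (· ∈ Z.carrier) i := by
  classical
  set m := Nat.nth (· ∈ Z.carrier) i with hm
  have hcount : Nat.count (· ∈ Z'.carrier) m = i := by
    rw [← Nat.count_nth_of_infinite (p := (· ∈ Z.carrier)) Z.infinite i, ← hm,
      Nat.count_eq_card_filter_range, Nat.count_eq_card_filter_range]
    congr 1
    ext k
    simp only [Finset.mem_filter, Finset.mem_range, and_congr_right_iff]
    exact fun hk => ⟨fun h => h1 h, h2 k (hk.trans hi)⟩
  have := Nat.nth_count (p := (· ∈ Z'.carrier)) (h2 m hi (Nat.nth_mem_of_infinite Z.infinite i))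
  rwa [hcount] at this

/-- Analytic sets are homogeneous for finitary images of increasing sequences. -/
theorem exists_homogeneous_strictMono {g : (ℕ → ℕ) → ℕ → ℕ} (hg : Finitary g) {A : Set (ℕ → ℕ)}
    (hA : MeasureTheory.AnalyticSet A) : ∃ H : Set ℕ, H.Infinite ∧
      ((∀ x, StrictMono x → (∀ i, x i ∈ H) → g x ∈ A) ∨
        ∀ x, StrictMono x → (∀ i, x i ∈ H) → g x ∉ A) := by
  let e : InfSet → ℕ → ℕ := fun Z => Nat.nth (· ∈ Z.carrier)
  have he : Continuous e := InfSet.continuous_iff.2 fun Z k =>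
    ⟨e Z k + 1, fun Z' h1 h2 => nth_eq_of_agree h1 h2 (Nat.lt_succ_self _)⟩
  obtain ⟨H, hH, h⟩ := exists_homogeneous (hg.continuous.comp he) hA
  have key : ∀ x : ℕ → ℕ, StrictMono x → (∀ i, x i ∈ H) →
      ∃ Z : InfSet, Z.carrier ⊆ H ∧ e Z = x := fun x hx hxH => by
    let Z : InfSet := ⟨range x, infinite_range_of_injective hx.injective⟩
    refine ⟨Z, range_subset_iff.2 hxH, ?_⟩
    refine (StrictMono.range_inj (Nat.nth_strictMono Z.infinite) hx).1 ?_
    exact Nat.range_nth_of_infinite Z.infinite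
  refine ⟨H, hH, h.imp (fun h x hx hxH => ?_) fun h x hx hxH => ?_⟩ <;>
  · obtain ⟨Z, hZ, rfl⟩ := key x hx hxH
    exact h Z hZ

/-- Analytic sets are homogeneous for finitary images of doughnuts. -/
theorem exists_homogeneous_doughnut {g : (ℕ → ℕ) → ℕ → ℕ} (hg : Finitary g) {A : Set (ℕ → ℕ)}
    (hA : MeasureTheory.AnalyticSet A) : ∃ (D : Set ℕ) (e : ℕ → ℕ), D.Infinite ∧ (∀ i, e i < 2) ∧
      ((∀ x, (∀ i, x i < 2) → (∀ i ∉ D, x i = e i) → g x ∈ A) ∨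
        ∀ x, (∀ i, x i < 2) → (∀ i ∉ D, x i = e i) → g x ∉ A) := by
  classical
  let c : InfSet → ℕ → ℕ := fun Z i => if i ∈ Z.carrier then 1 else 0
  have hc : Continuous c := InfSet.continuous_iff.2 fun Z k => ⟨k + 1, fun Z' h1 h2 => by
    have : k ∈ Z'.carrier ↔ k ∈ Z.carrier := ⟨fun h => h1 h, h2 k (Nat.lt_succ_self k)⟩
    simp [c, this]⟩
  obtain ⟨H, hH, h⟩ := exists_homogeneous (hg.continuous.comp hc) hA
  let ν : ℕ → ℕ := Nat.nth (· ∈ H)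
  have hν : StrictMono ν := Nat.nth_strictMono hH
  have hνH : ∀ i, ν i ∈ H := Nat.nth_mem_of_infinite hH
  let D : Set ℕ := range fun i => ν (2 * i + 1)
  let E : Set ℕ := range fun i => ν (2 * i)
  have hE : E.Infinite := infinite_range_of_injective fun i j hij => by
    have := hν.injective hij
    omega
  have hED : ∀ i ∈ E, i ∉ D := by
    rintro _ ⟨i, rfl⟩ ⟨j, hj⟩
    have := hν.injective hj
    omega
  let e : ℕ → ℕ := fun i => if i ∈ E then 1 else 0
  have key : ∀ x : ℕ → ℕ, (∀ i, x i < 2) → (∀ i ∉ D, x i = e i) →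
      ∃ Z : InfSet, Z.carrier ⊆ H ∧ c Z = x := fun x hx hxD => by
    refine ⟨⟨{i | x i = 1}, hE.mono fun i hi => ?_⟩, fun i hi => ?_, ?_⟩
    · rw [mem_ofPred_eq, hxD i (hED i hi)]
      simp [e, hi]
    · by_contra hiH
      have h1 : i ∉ D := by rintro ⟨j, rfl⟩; exact hiH (hνH _)
      have h2 : i ∉ E := by rintro ⟨j, rfl⟩; exact hiH (hνH _)
      have h3 : x i = 1 := hi
      rw [hxD i h1] at h3
      simp [e, h2] at h3
    · funext i
      have := hx i
      by_cases h : x i = 1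
      · simp [c, h]
      · simp [c, h]; omega
  refine ⟨D, e, infinite_range_of_injective fun i j hij => ?_, fun i => ?_,
    h.imp (fun h x hx hxH => ?_) fun h x hx hxH => ?_⟩
  · have := hν.injective hij
    omega
  · simp only [e]; split_ifs <;> omega
  all_goals
    obtain ⟨Z, hZ, rfl⟩ := key x hx hxH
    exact h Z hZ

@[simp] theorem getElem_initSeg (x : ℕ → ℕ) (n i : ℕ) (hi : i < (initSeg x n).length) :
    (initSeg x n)[i] = x i := by
  simp [initSeg]

theorem eq_empty_or_eq_empty {g : (ℕ → ℕ) → ℕ → ℕ} {A B : Set (ℕ → ℕ)} {p : (ℕ → ℕ) → Prop}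
    (h : (∀ x, p x → g x ∈ A) ∨ ∀ x, p x → g x ∉ A) (hB : ∀ y ∈ B, ∃ x, p x ∧ g x = y) :
    B ∩ A = ∅ ∨ B ∩ Aᶜ = ∅ := by
  rcases h with h | h
  · refine Or.inr (eq_empty_of_forall_notMem fun y hy => ?_)
    obtain ⟨x, hx, rfl⟩ := hB y hy.1
    exact hy.2 (h x hx)
  · refine Or.inl (eq_empty_of_forall_notMem fun y hy => ?_)
    obtain ⟨x, hx, rfl⟩ := hB y hy.1
    exact h x hx hy.2

/-! ### Prikry–Silver forcing -/

/-- The uniform binary tree with free coordinates in `L` and prescribed values `v` elsewhere. -/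
def uniformTree (L : Set ℕ) (v : ℕ → ℕ) : Descriptive.tree ℕ where
  val := {s | ∀ (n : ℕ) (h : n < s.length), s[n] < 2 ∧ (n ∉ L → s[n] = v n)}
  property := by
    intro s k h n hn
    have := h n (by simp; omega)
    rwa [List.getElem_append_left hn] at this

theorem mem_uniformTree {L : Set ℕ} {v : ℕ → ℕ} {s : List ℕ} : s ∈ uniformTree L v ↔
    ∀ (n : ℕ) (h : n < s.length), s[n] < 2 ∧ (n ∉ L → s[n] = v n) := Iff.rfl

theorem append_mem_uniformTree {L : Set ℕ} {v : ℕ → ℕ} {s : List ℕ} {i : ℕ} :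
    s ++ [i] ∈ uniformTree L v ↔
      s ∈ uniformTree L v ∧ i < 2 ∧ (s.length ∉ L → i = v s.length) := by
  simp only [mem_uniformTree]
  refine ⟨fun h => ⟨fun n hn => ?_, ?_⟩, fun h n hn => ?_⟩
  · have := h n (by simp; omega)
    rwa [List.getElem_append_left hn] at this
  · simpa using h s.length (by simp)
  · rcases Nat.lt_or_ge n s.length with hlt | hge
    · rw [List.getElem_append_left hlt]
      exact h.1 n hlt
    · obtain rfl : n = s.length := by simp at hn; omega
      simpa using h.2

theorem mem_branches_uniformTree {L : Set ℕ} {v : ℕ → ℕ} {y : ℕ → ℕ} :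
    y ∈ branches (uniformTree L v) ↔ ∀ n, y n < 2 ∧ (n ∉ L → y n = v n) := by
  refine ⟨fun h n => ?_, fun h n k hk => by simpa using h k⟩
  simpa using h (n + 1) n (by simp)

theorem isUniformPerfect_uniformTree {L : Set ℕ} (hL : L.Infinite) {v : ℕ → ℕ}
    (hv : ∀ n, v n < 2) : IsUniformPerfect (uniformTree L v) := by
  refine ⟨⟨fun n hn => by simp at hn, fun t ht n hn => ?_, fun t ht => ?_⟩,
    fun t₁ h₁ t₂ h₂ h => by simp [append_mem_uniformTree, h₁, h₂, h]⟩
  · obtain ⟨i, hi, rfl⟩ := List.mem_iff_getElem.1 hn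
    exact (ht i hi).1
  · have hext : ∀ k, ∃ u ∈ uniformTree L v, t <+: u ∧ u.length = t.length + k := by
      intro k
      induction k with
      | zero => exact ⟨t, ht, List.prefix_rfl, rfl⟩
      | succ k ih =>
        obtain ⟨u, hu, htu, hlen⟩ := ih
        exact ⟨u ++ [v u.length], append_mem_uniformTree.2 ⟨hu, hv _, fun _ => rfl⟩,
          htu.trans (List.prefix_append _ _), by simp [hlen, add_assoc]⟩
    obtain ⟨n, hnL, hn⟩ := hL.exists_gt t.length
    obtain ⟨u, hu, htu, hlen⟩ := hext (n - t.length)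
    have hlen' : u.length = n := by omega
    refine ⟨u, htu, hu, 0, ?_, 1, ?_, zero_ne_one⟩
    · exact append_mem_uniformTree.2 ⟨hu, by omega, fun h => (h (hlen' ▸ hnL)).elim⟩
    · exact append_mem_uniformTree.2 ⟨hu, by omega, fun h => (h (hlen' ▸ hnL)).elim⟩

theorem mem_of_prefix {T : Descriptive.tree ℕ} {s t : List ℕ} (h : s <+: t) (ht : t ∈ T) :
    s ∈ T := Descriptive.Tree.mem_of_prefix h ht

theorem exists_append_mem {T : Descriptive.tree ℕ}
    (hT : ∀ t ∈ T, ∃ u, t <+: u ∧ IsSplitting T u) {t : List ℕ} (ht : t ∈ T) :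
    ∃ n, t ++ [n] ∈ T := by
  obtain ⟨u, ⟨w, rfl⟩, hu, hs⟩ := hT t ht
  cases w with
  | nil =>
    obtain ⟨n, hn⟩ := hs.nonempty
    exact ⟨n, by simpa [succ] using hn⟩
  | cons n w => exact ⟨n, mem_of_prefix ⟨w, by simp⟩ hu⟩

theorem succ_eq_of_isBinary {T : Descriptive.tree ℕ} (hT : IsBinary T) {t : List ℕ}
    (ht : IsSplitting T t) : succ T t = {0, 1} := by
  have hlt : ∀ n ∈ succ T t, n < 2 := fun n hn => hT _ hn n (by simp)
  obtain ⟨m, hm, n, hn, hmn⟩ := ht.2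
  have h1 := hlt m hm
  have h2 := hlt n hn
  ext k
  refine ⟨fun hk => ?_, ?_⟩
  · have := hlt k hk
    simp; omega
  · have : (m = 0 ∧ n = 1) ∨ (m = 1 ∧ n = 0) := by omega
    rcases this with ⟨rfl, rfl⟩ | ⟨rfl, rfl⟩ <;> rintro (rfl | rfl) <;> assumption

/-- Uniformity makes the successors depend on the level alone, so one node `t n` per level suffices:
`L` collects the splitting levels, and elsewhere `v n` is the only successor. -/
theorem IsUniformPerfect.exists_eq_uniformTree {T : Descriptive.tree ℕ} (hT : IsUniformPerfect T) :
    ∃ (L : Set ℕ) (v : ℕ → ℕ), L.Infinite ∧ (∀ n, v n < 2) ∧ T = uniformTree L v := by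
  classical
  obtain ⟨⟨hnil, hbin, hsplit⟩, hunif⟩ := hT
  have hlevel : ∀ n, ∃ t ∈ T, t.length = n := by
    intro n
    induction n with
    | zero => exact ⟨[], hnil, rfl⟩
    | succ n ih =>
      obtain ⟨t, ht, rfl⟩ := ih
      obtain ⟨k, hk⟩ := exists_append_mem hsplit ht
      exact ⟨_, hk, by simp⟩
  choose t ht hlen using hlevel
  have hsucc : ∀ s ∈ T, ∀ i, s ++ [i] ∈ T ↔ t s.length ++ [i] ∈ T := fun s hs i => by
    have h := hunif s hs (t s.length) (ht _) (hlen _).symm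
    refine ⟨fun h' => ?_, fun h' => ?_⟩
    all_goals
      have hi : i < 2 := hbin _ h' i (by simp)
      interval_cases i
    exacts [h.1.1 h', h.2.1 h', h.1.2 h', h.2.2 h']
  have hex : ∀ n, ∃ i, t n ++ [i] ∈ T := fun n => exists_append_mem hsplit (ht n)
  choose v hv using hex
  refine ⟨{n | IsSplitting T (t n)}, v, infinite_of_forall_exists_gt fun n => ?_,
    fun n => hbin _ (hv n) _ (by simp), ?_⟩
  · obtain ⟨u, hu, hs⟩ := hsplit (t (n + 1)) (ht _)
    refine ⟨u.length, ⟨ht _, ?_⟩, by have := hu.length_le; rw [hlen] at this; omega⟩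
    exact hs.2.mono fun i hi => (hsucc u hs.1 i).1 hi
  · refine SetLike.ext fun s => ?_
    induction s using List.reverseRecOn with
    | nil => exact ⟨fun _ n hn => by simp at hn, fun _ => hnil⟩
    | append_singleton s i ih =>
      rw [append_mem_uniformTree, ← ih]
      refine ⟨fun h => ?_, fun ⟨hs, hi, h⟩ => (hsucc s hs i).2 ?_⟩
      · have hs : s ∈ T := mem_of_prefix (List.prefix_append _ _) h
        refine ⟨hs, hbin _ h _ (by simp), fun hns => ?_⟩
        by_contra hne
        exact hns ⟨ht _, i, (hsucc s hs i).1 h, _, hv _, hne⟩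
      · by_cases hsp : IsSplitting T (t s.length)
        · have : i ∈ succ T (t s.length) := by
            rw [succ_eq_of_isBinary hbin hsp]
            simp; omega
          exact this
        · rw [h hsp]
          exact hv _

theorem isMeasurableFor_prikrySilver {A : Set (ℕ → ℕ)} (hA : MeasureTheory.AnalyticSet A) :
    IsMeasurableFor PrikrySilver (fun p => branches p.1) A := by
  classical
  rintro ⟨T, hT⟩
  obtain ⟨L, v, hL, hv, rfl⟩ := hT.exists_eq_uniformTree
  let g : (ℕ → ℕ) → ℕ → ℕ := fun x n => if n ∈ L then x (Nat.count (· ∈ L) n) else v n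
  have hg : Finitary g := fun k => ⟨Nat.count (· ∈ L) k + 1, fun x y h => by
    simp only [g]
    rw [h _ (Nat.lt_succ_self _)]⟩
  obtain ⟨D, e, hD, he, h⟩ := exists_homogeneous_doughnut hg hA
  let ν := Nat.nth (· ∈ L)
  have hν : Function.Injective ν := Nat.nth_injective hL
  have hνL : ∀ i, ν i ∈ L := Nat.nth_mem_of_infinite hL
  have hcν : ∀ i, Nat.count (· ∈ L) (ν i) = i := Nat.count_nth_of_infinite hL
  have hνc : ∀ n ∈ L, ν (Nat.count (· ∈ L) n) = n := fun n hn => Nat.nth_count hn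
  refine ⟨⟨uniformTree (ν '' D) (g e), isUniformPerfect_uniformTree (hD.image hν.injOn) fun n => ?_⟩,
    fun s hs n hn => ⟨(hs n hn).1, fun hnL => ?_⟩, ?_⟩
  · simp only [g]
    split_ifs
    exacts [he _, hv n]
  · rw [(hs n hn).2 fun ⟨i, _, hi⟩ => hnL (hi ▸ hνL i)]
    simp [g, hnL]
  · refine eq_empty_or_eq_empty (h.imp (fun h x (hx : _ ∧ _) => h x hx.1 hx.2)
      fun h x (hx : _ ∧ _) => h x hx.1 hx.2) fun y hy => ?_
    rw [mem_branches_uniformTree] at hy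
    refine ⟨fun i => y (ν i), ⟨fun i => (hy _).1, fun i hi => ?_⟩, funext fun n => ?_⟩
    · change y (ν i) = e i
      rw [(hy (ν i)).2 fun ⟨j, hj, hji⟩ => hi (hν hji ▸ hj)]
      simp [g, hνL, hcν]
    · by_cases hn : n ∈ L
      · simp [g, hn, hνc]
      · rw [(hy n).2 fun ⟨j, hj, hji⟩ => hn (hji ▸ hνL j)]
        simp [g, hn]

/-! ### Willowtree forcing -/

theorem isMeasurableFor_willowtree {A : Set (ℕ → ℕ)} (hA : MeasureTheory.AnalyticSet A) :
    IsMeasurableFor Willowtree (fun p => branches p.tree) A := by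
  classical
  intro W
  have : Infinite W.blocks := W.infinite.to_subtype
  obtain ⟨_⟩ := nonempty_denumerable W.blocks
  let a : W.blocks ≃ ℕ := Denumerable.eqv W.blocks
  -- One bit per block: `x` gives the constant value on each block, and `W.f` decides the rest.
  let g : (ℕ → ℕ) → ℕ → ℕ := fun x n =>
    if h : ∃ b : W.blocks, n ∈ b.1 then x (a h.choose)
    else W.f ⟨n, fun b hb hn => h ⟨⟨b, hb⟩, hn⟩⟩
  have hgb : ∀ x (b : W.blocks), ∀ n ∈ b.1, g x n = x (a b) := fun x b n hn => by
    have h : ∃ b : W.blocks, n ∈ b.1 := ⟨b, hn⟩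
    have hb : h.choose = b := by
      by_contra hne
      exact Finset.disjoint_left.1 (W.disjoint _ h.choose.2 _ b.2 fun h' => hne (Subtype.ext h'))
        h.choose_spec hn
    simp only [g, dif_pos h, hb]
  have hgf : ∀ x n (h : ∀ b ∈ W.blocks, n ∉ b), g x n = W.f ⟨n, h⟩ := fun x n h =>
    dif_neg fun ⟨b, hb⟩ => h b b.2 hb
  have hg : Finitary g := fun k => by
    by_cases h : ∃ b : W.blocks, k ∈ b.1
    · obtain ⟨b, hb⟩ := h
      refine ⟨a b + 1, fun x y hxy => ?_⟩
      rw [hgb x b k hb, hgb y b k hb, hxy _ (Nat.lt_succ_self _)]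
    · refine ⟨0, fun x y _ => ?_⟩
      rw [hgf x k fun b hb hk => h ⟨⟨b, hb⟩, hk⟩, hgf y k fun b hb hk => h ⟨⟨b, hb⟩, hk⟩]
  obtain ⟨D, e, hD, he, h⟩ := exists_homogeneous_doughnut hg hA
  have hg2 : ∀ n, g e n < 2 := fun n => by
    by_cases h : ∃ b : W.blocks, n ∈ b.1
    · obtain ⟨b, hb⟩ := h
      rw [hgb e b n hb]
      exact he _
    · rw [hgf e n fun b hb hk => h ⟨⟨b, hb⟩, hk⟩]
      exact Fin.is_lt _
  -- Blocks with index outside `D` are dissolved into the domain of the new function, with the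
  -- values prescribed by `e`.
  let B : Set (Finset ℕ) := (fun i => (a.symm i).1) '' D
  have hBW : ∀ b ∈ B, b ∈ W.blocks := by
    rintro _ ⟨i, -, rfl⟩
    exact (a.symm i).2
  have haB : ∀ b : W.blocks, b.1 ∈ B ↔ a b ∈ D := fun b => by
    refine ⟨?_, fun h => ⟨a b, h, by simp⟩⟩
    rintro ⟨i, hi, hib⟩
    rw [← Subtype.ext hib]
    simpa using hi
  have hnB : ∀ b : W.blocks, a b ∉ D → ∀ n ∈ b.1, ∀ c ∈ B, n ∉ c := by
    intro b hb n hn c hc hnc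
    refine Finset.disjoint_left.1 (W.disjoint _ b.2 _ (hBW c hc) ?_) hn hnc
    rintro rfl
    exact hb ((haB b).1 hc)
  let W' : Willowtree :=
    { blocks := B
      infinite := hD.image fun i _ j _ hij => a.symm.injective (Subtype.ext hij)
      nonempty := fun b hb => W.nonempty b (hBW b hb)
      disjoint := fun b hb c hc => W.disjoint b (hBW b hb) c (hBW c hc)
      f := fun n => ⟨g e n.1, hg2 n.1⟩ }
  refine ⟨W', ?_, ?_⟩
  · rintro s ⟨h1, h2, h3⟩
    refine ⟨h1, fun n hn hf => ?_, fun b hb m hm n hn hm' hn' => ?_⟩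
    · rw [h2 n hn fun c hc => hf c (hBW c hc)]
      exact hgf e n hf
    · by_cases hbD : a ⟨b, hb⟩ ∈ D
      · exact h3 b ((haB ⟨b, hb⟩).2 hbD) m hm n hn hm' hn'
      · rw [h2 m hm' (hnB ⟨b, hb⟩ hbD m hm), h2 n hn' (hnB ⟨b, hb⟩ hbD n hn)]
        exact (hgb e ⟨b, hb⟩ m hm).trans (hgb e ⟨b, hb⟩ n hn).symm
  · refine eq_empty_or_eq_empty (h.imp (fun h x (hx : _ ∧ _) => h x hx.1 hx.2)
      fun h x (hx : _ ∧ _) => h x hx.1 hx.2) fun y hy => ?_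
    have y1 : ∀ n, y n < 2 := fun n => (hy (n + 1)).1 _ (by simp [initSeg_succ])
    have y2 : ∀ n, (∀ b ∈ B, n ∉ b) → y n = g e n := fun n hn => by
      simpa using (hy (n + 1)).2.1 n (by simp) hn
    have y3 : ∀ b ∈ B, ∀ m ∈ b, ∀ n ∈ b, y m = y n := fun b hb m hm n hn => by
      simpa using (hy (m + n + 1)).2.2 b hb m hm n hn
        (by rw [length_initSeg]; omega) (by rw [length_initSeg]; omega)
    -- A sample point in each block, from which the code of `y` is read off.
    choose c hc using fun i => W.nonempty _ (a.symm i).2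
    have hc' : ∀ b : W.blocks, c (a b) ∈ b.1 := fun b => by simpa using hc (a b)
    refine ⟨fun i => y (c i), ⟨fun i => y1 _, fun i hi => ?_⟩, funext fun n => ?_⟩
    · have := hnB (a.symm i) (by simpa using hi) (c i) (hc i)
      change y (c i) = e i
      rw [y2 _ this, hgb e _ _ (hc i), a.apply_symm_apply]
    · by_cases hn : ∃ b : W.blocks, n ∈ b.1
      · obtain ⟨b, hb⟩ := hn
        refine (hgb (fun i => y (c i)) b n hb).trans ?_
        by_cases hbD : a b ∈ D
        · exact y3 b ((haB b).2 hbD) _ (hc' b) _ hb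
        · rw [y2 _ (hnB b hbD _ (hc' b)), y2 _ (hnB b hbD _ hb), hgb e b _ (hc' b), hgb e b _ hb]
      · have hn' : ∀ b ∈ W.blocks, n ∉ b := fun b hb hk => hn ⟨⟨b, hb⟩, hk⟩
        rw [hgf (fun i => y (c i)) n hn', y2 n fun b hb => hn' b (hBW b hb), hgf e n hn']

/-! ### Matet forcing -/

theorem isMeasurableFor_matet {A : Set (ℕ → ℕ)} (hA : MeasureTheory.AnalyticSet A) :
    IsMeasurableFor Matet (fun p => p.body) A := by
  intro p
  obtain ⟨a, ha0, hblocks, hinc, hne, hlt⟩ := p.exists_enum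
  have hlt' : ∀ i d, ∀ m ∈ a i, ∀ n ∈ a (i + d + 1), m < n := by
    intro i d
    induction d with
    | zero => exact hlt i
    | succ d ih =>
      intro m hm n hn
      obtain ⟨k, hk⟩ := List.exists_mem_of_ne_nil _ (hne (i + d))
      exact (ih m hm k hk).trans (hlt _ k hk n hn)
  have hlt'' : ∀ i j, i < j → ∀ m ∈ a i, ∀ n ∈ a j, m < n := fun i j hij => by
    obtain ⟨d, rfl⟩ := Nat.exists_eq_add_of_lt hij
    exact hlt' i d
  let G : (ℕ → ℕ) → ℕ → List ℕ := fun x k =>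
    a 0 ++ ((List.range k).map fun i => a (x i + 1)).flatten
  have hGlen : ∀ x k, k ≤ (G x k).length := fun x k => by
    induction k with
    | zero => exact Nat.zero_le _
    | succ k ih =>
      have : 0 < (a (x k + 1)).length := List.length_pos_iff.2 (hne _)
      simp only [G, List.range_succ, List.map_append, List.flatten_append, List.length_append,
        List.map_cons, List.map_nil, List.flatten_cons, List.flatten_nil, List.length_nil] at ih ⊢
      omega
  -- Blocks are non-empty, so `k + 1` of them cover position `k` and the default 0 is never used.
  let g : (ℕ → ℕ) → ℕ → ℕ := fun x k => (G x (k + 1)).getD k 0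
  have hg : Finitary g := fun k => ⟨k + 1, fun x y hxy => by
    have : G x (k + 1) = G y (k + 1) := by
      simp only [G]
      congr 2
      exact List.map_congr_left fun i hi => by rw [hxy i (List.mem_range.1 hi)]
    simp only [g, this]⟩
  obtain ⟨H, hH, h⟩ := exists_homogeneous_strictMono hg hA
  let ν := Nat.nth (· ∈ H)
  have hν : StrictMono ν := Nat.nth_strictMono hH
  have hνH : ∀ i, ν i ∈ H := Nat.nth_mem_of_infinite hH
  let p' : Matet :=
    { stem := p.stem
      blocks := range fun i => a (ν i + 1)
      exists_enum := by
        refine ⟨fun i => Nat.casesOn i (a 0) fun i => a (ν i + 1), ha0, rfl, ?_,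
          fun i => hne _, ?_⟩
        · rintro (_ | i)
          exacts [hinc 0, hinc _]
        · rintro (_ | i)
          · exact hlt'' _ _ (Nat.succ_pos _)
          · exact hlt'' _ _ (Nat.succ_lt_succ (hν (Nat.lt_succ_self i))) }
  refine ⟨p', ⟨List.prefix_rfl, ?_, [], by simp, by simp [p']⟩, ?_⟩
  · rintro _ ⟨i, rfl⟩
    exact ⟨[a (ν i + 1)], by simp [hblocks], by simp⟩
  · refine eq_empty_or_eq_empty (h.imp (fun h x (hx : _ ∧ _) => h x hx.1 hx.2)
      fun h x (hx : _ ∧ _) => h x hx.1 hx.2) ?_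
    rintro y ⟨c, hc, hcinc, hy⟩
    choose j hj using hc
    obtain rfl : (fun i => a (ν (j i) + 1)) = c := funext hj
    refine ⟨fun i => ν (j i), ⟨strictMono_nat_of_lt_succ fun i => ?_, fun i => hνH _⟩,
      funext fun k => ?_⟩
    · obtain ⟨m, hm⟩ := List.exists_mem_of_ne_nil _ (hne (ν (j i)))
      obtain ⟨n, hn⟩ := List.exists_mem_of_ne_nil _ (hne (ν (j (i + 1))))
      have hmn := hcinc i m hm n hn
      by_contra hcon
      rcases (not_lt.1 hcon).eq_or_lt with heq | hlt
      · refine lt_irrefl m (hcinc i m hm m ?_)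
        change m ∈ a (ν (j (i + 1)) + 1)
        rwa [heq]
      · exact lt_asymm hmn (hlt'' _ _ (Nat.succ_lt_succ hlt) n hn m hm)
    · obtain ⟨n, hn⟩ := hy (k + 1)
      have hn' : initSeg y n = G (fun i => ν (j i)) (k + 1) := by rw [hn]; simp only [G, ha0, p']
      have hlen := hGlen (fun i => ν (j i)) (k + 1)
      simp only [g, ← hn'] at hlen ⊢
      rw [List.getD_eq_getElem _ _ (by omega), getElem_initSeg]

/-! ### Codes of nodes -/

open Classical in
/-- The number of elements of `S` below `n`. -/
noncomputable def rank (S : Set ℕ) (n : ℕ) : ℕ := Nat.count (· ∈ S) n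

theorem nth_rank {S : Set ℕ} {n : ℕ} (hn : n ∈ S) : Nat.nth (· ∈ S) (rank S n) = n := by
  classical
  simpa [rank] using Nat.nth_count (p := (· ∈ S)) hn

theorem rank_nth {S : Set ℕ} (hS : S.Infinite) (k : ℕ) : rank S (Nat.nth (· ∈ S) k) = k := by
  classical
  simpa [rank] using Nat.count_nth_of_infinite (p := (· ∈ S)) hS k

open Classical in
/-- The ranks of the choices that `t` makes after `s` at splitting nodes of `T`. -/
noncomputable def codeFrom (T : Descriptive.tree ℕ) (s : List ℕ) : List ℕ → List ℕ
  | [] => []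
  | n :: t => (if IsSplitting T s then [rank (succ T s) n] else []) ++ codeFrom T (s ++ [n]) t

open Classical in
theorem codeFrom_append (T : Descriptive.tree ℕ) (s t : List ℕ) (n : ℕ) :
    codeFrom T s (t ++ [n]) = codeFrom T s t ++
      if IsSplitting T (s ++ t) then [rank (succ T (s ++ t)) n] else [] := by
  induction t generalizing s with
  | nil => simp [codeFrom]
  | cons k t ih => simp [codeFrom, ih]

/-- The ranks of the choices that `t` makes at splitting nodes of `T`. -/
noncomputable def code (T : Descriptive.tree ℕ) (t : List ℕ) : List ℕ := codeFrom T [] t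

@[simp] theorem code_nil (T : Descriptive.tree ℕ) : code T [] = [] := rfl

theorem code_append_of_isSplitting {T : Descriptive.tree ℕ} {t : List ℕ} (ht : IsSplitting T t)
    (n : ℕ) : code T (t ++ [n]) = code T t ++ [rank (succ T t) n] := by
  simp [code, codeFrom_append, ht]

theorem code_append_of_not_isSplitting {T : Descriptive.tree ℕ} {t : List ℕ}
    (ht : ¬ IsSplitting T t) (n : ℕ) : code T (t ++ [n]) = code T t := by
  simp [code, codeFrom_append, ht]

theorem code_prefix_append (T : Descriptive.tree ℕ) (t : List ℕ) (n : ℕ) :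
    code T t <+: code T (t ++ [n]) := by
  by_cases h : IsSplitting T t
  · rw [code_append_of_isSplitting h]
    exact List.prefix_append _ _
  · rw [code_append_of_not_isSplitting h]

theorem code_prefix (T : Descriptive.tree ℕ) {s t : List ℕ} (h : s <+: t) :
    code T s <+: code T t := by
  obtain ⟨w, rfl⟩ := h
  induction w using List.reverseRecOn with
  | nil => simp
  | append_singleton w n ih =>
    rw [← List.append_assoc]
    exact ih.trans (code_prefix_append T _ n)

theorem length_code_le (T : Descriptive.tree ℕ) (t : List ℕ) :
    (code T t).length ≤ t.length := by
  induction t using List.reverseRecOn with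
  | nil => simp
  | append_singleton t n ih =>
    by_cases h : IsSplitting T t
    · simpa [code_append_of_isSplitting h] using ih
    · simp only [code_append_of_not_isSplitting h, List.length_append]
      omega

/-- The subtree of all nodes of `T` with code in `R`. -/
def subtree (T R : Descriptive.tree ℕ) : Descriptive.tree ℕ where
  val := {t | t ∈ T ∧ code T t ∈ R}
  property := fun t n h => ⟨mem_of_prefix (List.prefix_append t [n]) h.1,
    mem_of_prefix (code_prefix_append T t n) h.2⟩

theorem subtree_le (T R : Descriptive.tree ℕ) : subtree T R ≤ T := fun _ h => h.1

theorem mem_succ_subtree {T R : Descriptive.tree ℕ} {t : List ℕ} (ht : IsSplitting T t) {n : ℕ} :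
    n ∈ succ (subtree T R) t ↔ n ∈ succ T t ∧ code T t ++ [rank (succ T t) n] ∈ R := by
  rw [← code_append_of_isSplitting ht]
  exact Iff.rfl

/-- Going up to the first splitting node involves no choice, so the code does not grow. -/
theorem exists_isSplitting_code_eq {T : Descriptive.tree ℕ}
    (hT : ∀ t ∈ T, ∃ u, t <+: u ∧ IsSplitting T u) {t : List ℕ} (ht : t ∈ T) :
    ∃ u, t <+: u ∧ IsSplitting T u ∧ code T u = code T t := by
  obtain ⟨_, ⟨w, rfl⟩, hu⟩ := hT t ht
  induction w generalizing t with
  | nil => exact ⟨t, List.prefix_rfl, by simpa using hu, rfl⟩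
  | cons n w ih =>
    by_cases h : IsSplitting T t
    · exact ⟨t, List.prefix_rfl, h, rfl⟩
    · obtain ⟨u, h1, h2, h3⟩ := ih (t := t ++ [n])
        (mem_of_prefix ⟨w, by simp⟩ hu.1) (by simpa using hu)
      exact ⟨u, (List.prefix_append _ _).trans h1, h2,
        h3.trans (code_append_of_not_isSplitting h n)⟩

/-- Lifts an extension in `R` to one in `T`; `hR` says that every entry occurring in `R` is the rank
of some successor at each splitting node. -/
theorem exists_isSplitting_code_eq_append {T R : Descriptive.tree ℕ}
    (hT : ∀ t ∈ T, ∃ u, t <+: u ∧ IsSplitting T u)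
    (hR : ∀ u, IsSplitting T u → ∀ s ∈ R, ∀ k ∈ s, ∃ n ∈ succ T u, rank (succ T u) n = k)
    {t : List ℕ} (ht : t ∈ T) (w : List ℕ) (hw : code T t ++ w ∈ R) :
    ∃ u, t <+: u ∧ IsSplitting T u ∧ code T u = code T t ++ w := by
  induction w generalizing t with
  | nil => simpa using exists_isSplitting_code_eq hT ht
  | cons k w ih =>
    obtain ⟨u, htu, hu, hcu⟩ := exists_isSplitting_code_eq hT ht
    obtain ⟨n, hn, rfl⟩ := hR u hu _ hw k (by simp)
    have hc : code T (u ++ [n]) ++ w = code T t ++ rank (succ T u) n :: w := by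
      rw [code_append_of_isSplitting hu, hcu]
      simp
    obtain ⟨u', h1, h2, h3⟩ := ih (t := u ++ [n]) hn (hc ▸ hw)
    exact ⟨u', (htu.trans (List.prefix_append _ _)).trans h1, h2, h3.trans hc⟩

theorem initSeg_prefix (y : ℕ → ℕ) {m n : ℕ} (h : m ≤ n) : initSeg y m <+: initSeg y n := by
  rw [List.prefix_iff_eq_take]
  exact List.ext_getElem (by simp [h]) fun j h1 h2 => by simp

theorem exists_isSplitting_initSeg {T : Descriptive.tree ℕ}
    (hT : ∀ t ∈ T, ∃ u, t <+: u ∧ IsSplitting T u) {y : ℕ → ℕ} (hy : y ∈ branches T) (n : ℕ) :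
    ∃ m ≥ n, IsSplitting T (initSeg y m) := by
  by_contra! hcon
  obtain ⟨_, ⟨w, rfl⟩, hu⟩ := hT _ (hy n)
  have key : ∀ w, initSeg y n ++ w ∈ T → initSeg y n ++ w = initSeg y (n + w.length) := by
    intro w
    induction w using List.reverseRecOn with
    | nil => simp
    | append_singleton w k ih =>
      intro hw
      rw [← List.append_assoc] at hw ⊢
      have ih' := ih (mem_of_prefix (List.prefix_append _ _) hw)
      rw [ih'] at hw ⊢
      rw [List.length_append, List.length_singleton, ← add_assoc, initSeg_succ]
      congr 2
      by_contra hne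
      refine hcon (n + w.length) (Nat.le_add_right _ _) ⟨hy _, k, hw, y (n + w.length), ?_, hne⟩
      have := hy (n + w.length + 1)
      rwa [initSeg_succ] at this
  exact hcon (n + w.length) (Nat.le_add_right _ _) (key w hu.1 ▸ hu)

open Classical in
/-- The next choice at the node `u` of a branch with code `x`. -/
noncomputable def choice (T : Descriptive.tree ℕ) (x : ℕ → ℕ) (u : List ℕ) : ℕ :=
  -- Off the splitting nodes, index 0 picks the only successor on a branch.
  Nat.nth (· ∈ succ T u) (if IsSplitting T u then x (code T u).length else 0)

/-- The branch of `T` with code `x`. -/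
noncomputable def decode (T : Descriptive.tree ℕ) (x : ℕ → ℕ) : ℕ → ℕ :=
  (exists_path (choice T x)).choose

theorem decode_apply (T : Descriptive.tree ℕ) (x : ℕ → ℕ) (n : ℕ) :
    decode T x n = choice T x (initSeg (decode T x) n) := (exists_path (choice T x)).choose_spec n

theorem choice_congr {T : Descriptive.tree ℕ} {x y : ℕ → ℕ} {u : List ℕ}
    (h : x (code T u).length = y (code T u).length) : choice T x u = choice T y u := by
  simp [choice, h]

theorem finitary_decode (T : Descriptive.tree ℕ) : Finitary (decode T) := by
  refine fun k => ⟨k + 1, fun x y h => ?_⟩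
  induction k using Nat.strong_induction_on with
  | h k ih =>
    have : initSeg (decode T x) k = initSeg (decode T y) k :=
      initSeg_eq_initSeg.2 fun i hi => ih i hi fun j hj => h j (by omega)
    rw [decode_apply, decode_apply, this]
    refine choice_congr (h _ (Nat.lt_succ_of_le ?_))
    simpa using length_code_le T (initSeg (decode T y) k)

theorem eq_decode {T : Descriptive.tree ℕ} {x y : ℕ → ℕ} (h : ∀ n, y n = choice T x (initSeg y n)) :
    decode T x = y := by
  funext n
  induction n using Nat.strong_induction_on with
  | h n ih => rw [decode_apply, h n, initSeg_eq_initSeg.2 ih]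

/-- A branch splits infinitely often, so the codes of its initial segments grow to an infinite
sequence `x`; nodes of the subtree have codes in `R`, hence `x` is a branch of `R`. -/
theorem exists_decode_eq {T R : Descriptive.tree ℕ}
    (hT : ∀ t ∈ T, ∃ u, t <+: u ∧ IsSplitting T u) {y : ℕ → ℕ} (hy : y ∈ branches (subtree T R)) :
    ∃ x ∈ branches R, decode T x = y := by
  have hyT : y ∈ branches T := fun n => (hy n).1
  have hlen : ∀ i, ∃ n, i < (code T (initSeg y n)).length := by
    intro i
    induction i with
    | zero =>
      obtain ⟨m, -, hm⟩ := exists_isSplitting_initSeg hT hyT 0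
      exact ⟨m + 1, by simp [initSeg_succ, code_append_of_isSplitting hm]⟩
    | succ i ih =>
      obtain ⟨n, hn⟩ := ih
      obtain ⟨m, hnm, hm⟩ := exists_isSplitting_initSeg hT hyT n
      have := (code_prefix T (initSeg_prefix y hnm)).length_le
      refine ⟨m + 1, ?_⟩
      rw [initSeg_succ, code_append_of_isSplitting hm, List.length_append, List.length_singleton]
      omega
  choose ν hν using hlen
  let x : ℕ → ℕ := fun i => (code T (initSeg y (ν i)))[i]'(hν i)
  have hx : ∀ n i (h : i < (code T (initSeg y n)).length), (code T (initSeg y n))[i] = x i := by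
    intro n i h
    rcases le_total n (ν i) with h' | h'
    · exact (code_prefix T (initSeg_prefix y h')).getElem h
    · exact ((code_prefix T (initSeg_prefix y h')).getElem (hν i)).symm
  refine ⟨x, fun i => ?_, eq_decode fun n => ?_⟩
  · refine mem_of_prefix ?_ (hy (ν i)).2
    rw [List.prefix_iff_eq_take]
    refine List.ext_getElem (by simpa using (hν i).le) fun j h1 h2 => ?_
    rw [List.getElem_take, getElem_initSeg, hx]
  · have hmem : y n ∈ succ T (initSeg y n) := by
      have := hyT (n + 1)
      rwa [initSeg_succ] at this
    by_cases hs : IsSplitting T (initSeg y n)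
    · have h := hx (n + 1) (code T (initSeg y n)).length
        (by simp [initSeg_succ, code_append_of_isSplitting hs])
      simp only [initSeg_succ, code_append_of_isSplitting hs] at h
      rw [List.getElem_concat_length (h := rfl)] at h
      rw [choice, if_pos hs, ← h, nth_rank hmem]
    · have hsing : succ T (initSeg y n) = {y n} := by
        refine Subset.antisymm (fun k hk => ?_) (by simpa using hmem)
        by_contra hne
        exact hs ⟨hyT n, k, hk, _, hmem, hne⟩
      rw [choice, if_neg hs, hsing, Nat.nth_zero]
      simp

/-! ### Sacks forcing -/

theorem isMeasurableFor_sacks {A : Set (ℕ → ℕ)} (hA : MeasureTheory.AnalyticSet A) :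
    IsMeasurableFor Sacks (fun p => branches p.1) A := by
  rintro ⟨T, hnil, hbin, hT⟩
  obtain ⟨D, e, hD, he, h⟩ := exists_homogeneous_doughnut (finitary_decode T) hA
  have hR := (isUniformPerfect_uniformTree hD he).1
  -- At a binary splitting node the successors are 0 and 1, each equal to its own rank, so all
  -- binary codes are realized.
  have hex : ∀ u, IsSplitting T u → ∀ s ∈ uniformTree D e, ∀ k ∈ s,
      ∃ n ∈ succ T u, rank (succ T u) n = k := fun u hu s hs k hk => by
    have := hR.2.1 s hs k hk
    rw [succ_eq_of_isBinary hbin hu]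
    refine ⟨k, by simp; omega, ?_⟩
    interval_cases k <;> simp [rank, Nat.count_succ]
  refine ⟨⟨subtree T (uniformTree D e), ⟨hnil, hR.1⟩, fun t ht => hbin t ht.1, fun t ht => ?_⟩,
    subtree_le _ _, ?_⟩
  · obtain ⟨_, ⟨w, rfl⟩, hs, k, hk, l, hl, hkl⟩ := hR.2.2 _ ht.2
    obtain ⟨u, htu, hu, hcu⟩ := exists_isSplitting_code_eq_append hT hex ht.1 w hs
    obtain ⟨m, hm, rfl⟩ := hex u hu _ hk k (by simp)
    obtain ⟨n, hn, rfl⟩ := hex u hu _ hl l (by simp)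
    refine ⟨u, htu, ⟨hu.1, hcu ▸ hs⟩, m, ?_, n, ?_, fun hmn => hkl (by rw [hmn])⟩
    · rw [mem_succ_subtree hu, hcu]
      exact ⟨hm, hk⟩
    · rw [mem_succ_subtree hu, hcu]
      exact ⟨hn, hl⟩
  · refine eq_empty_or_eq_empty (h.imp (fun h x (hx : _ ∧ _) => h x hx.1 hx.2)
      fun h x (hx : _ ∧ _) => h x hx.1 hx.2) fun y hy => ?_
    obtain ⟨x, hx, hxy⟩ := exists_decode_eq hT hy
    rw [mem_branches_uniformTree] at hx
    exact ⟨x, ⟨fun i => (hx i).1, fun i => (hx i).2⟩, hxy⟩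

/-! ### Miller and Laver forcing -/

/-- The tree of increasing sequences from `H`. -/
def increasingTree (H : Set ℕ) : Descriptive.tree ℕ where
  val := {s | s.Pairwise (· < ·) ∧ ∀ k ∈ s, k ∈ H}
  property := fun s n h => ⟨(List.pairwise_append.1 h.1).1, fun k hk => h.2 k (by simp [hk])⟩

theorem mem_increasingTree {H : Set ℕ} {s : List ℕ} :
    s ∈ increasingTree H ↔ s.Pairwise (· < ·) ∧ ∀ k ∈ s, k ∈ H := Iff.rfl

theorem infinite_succ_increasingTree {H : Set ℕ} (hH : H.Infinite) {s : List ℕ}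
    (hs : s ∈ increasingTree H) : (succ (increasingTree H) s).Infinite := by
  refine (infinite_tail hH s.toFinset).mono fun n hn => mem_increasingTree.2 ⟨?_, fun k hk => ?_⟩
  · exact List.pairwise_append.2 ⟨hs.1, by simp, fun m hm k hk => by
      rw [List.mem_singleton.1 hk]; exact hn.2 m (by simpa using hm)⟩
  · rcases List.mem_append.1 hk with hk | hk
    · exact hs.2 k hk
    · rw [List.mem_singleton.1 hk]; exact hn.1

theorem strictMono_of_mem_branches {H : Set ℕ} {x : ℕ → ℕ} (hx : x ∈ branches (increasingTree H)) :
    StrictMono x ∧ ∀ i, x i ∈ H := by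
  refine ⟨strictMono_nat_of_lt_succ fun i => ?_, fun i => (hx (i + 1)).2 _ (by simp [initSeg_succ])⟩
  simpa using List.pairwise_iff_getElem.1 (hx (i + 2)).1 i (i + 1) (by simp) (by simp) (by simp)

/-- Common core of Miller and Laver forcing: keep the nodes whose codes increase within a
homogeneous `H`. Infinitely many next ranks stay allowed, so every surviving splitting node of `T`
remains ω-splitting. -/
theorem exists_homogeneous_subtree {A : Set (ℕ → ℕ)} (hA : MeasureTheory.AnalyticSet A)
    {T : Descriptive.tree ℕ} (hT : ∀ t ∈ T, ∃ u, t <+: u ∧ IsSplitting T u)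
    (hω : ∀ t ∈ T, IsSplitting T t → IsOmegaSplitting T t) :
    ∃ R : Descriptive.tree ℕ, [] ∈ R ∧
      (∀ t ∈ subtree T R, IsSplitting T t → IsOmegaSplitting (subtree T R) t) ∧
      (branches (subtree T R) ∩ A = ∅ ∨ branches (subtree T R) ∩ Aᶜ = ∅) := by
  obtain ⟨H, hH, h⟩ := exists_homogeneous_strictMono (finitary_decode T) hA
  refine ⟨increasingTree H, by simp [mem_increasingTree], fun t ht hs => ⟨ht, ?_⟩, ?_⟩
  · have hinf := (hω t ht.1 hs).2
    let ν := Nat.nth (· ∈ succ T t)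
    refine ((infinite_succ_increasingTree hH ht.2).image
      (f := ν) (Nat.nth_injective hinf).injOn).mono ?_
    rintro _ ⟨k, hk, rfl⟩
    refine (mem_succ_subtree hs).2 ⟨Nat.nth_mem_of_infinite hinf k, ?_⟩
    rw [rank_nth hinf]
    exact hk
  · refine eq_empty_or_eq_empty (h.imp (fun h x (hx : _ ∧ _) => h x hx.1 hx.2)
      fun h x (hx : _ ∧ _) => h x hx.1 hx.2) fun y hy => ?_
    obtain ⟨x, hx, hxy⟩ := exists_decode_eq hT hy
    exact ⟨x, strictMono_of_mem_branches hx, hxy⟩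

theorem isMeasurableFor_miller {A : Set (ℕ → ℕ)} (hA : MeasureTheory.AnalyticSet A) :
    IsMeasurableFor Miller (fun p => branches p.1) A := by
  rintro ⟨T, hnil, hω, hT⟩
  obtain ⟨R, hR, hsplit, h⟩ := exists_homogeneous_subtree hA hT hω
  refine ⟨⟨subtree T R, ⟨hnil, hR⟩, fun t ht hs => hsplit t ht ⟨ht.1, hs.2.mono fun _ h => h.1⟩,
    fun t ht => ?_⟩, subtree_le _ _, h⟩
  obtain ⟨u, htu, hu, hcu⟩ := exists_isSplitting_code_eq hT ht.1
  have hu' := hsplit u ⟨hu.1, hcu ▸ ht.2⟩ hu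
  exact ⟨u, htu, hu'.1, hu'.2.nontrivial⟩

theorem isMeasurableFor_laver {A : Set (ℕ → ℕ)} (hA : MeasureTheory.AnalyticSet A) :
    IsMeasurableFor Laver (fun p => branches p.1) A := by
  rintro ⟨T, s, hs, hcomp, hω⟩
  -- Nothing splits strictly below the stem, so the stem has empty code and survives in the subtree.
  have hns : ∀ u n, u ++ [n] <+: s → ¬ IsSplitting T u := by
    rintro u n hn ⟨-, hu⟩
    obtain ⟨k, hk, hne⟩ := hu.exists_ne n
    have : u ++ [n] <+: u ++ [k] := by
      rcases hcomp _ hk with h | h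
      · exact List.prefix_of_prefix_length_le hn h (by simp)
      · exact hn.trans h
    have := this.eq_of_length (by simp)
    simp only [List.append_cancel_left_eq, List.cons.injEq, and_true] at this
    exact hne this.symm
  have hcode : ∀ u, u <+: s → code T u = [] := by
    intro u
    induction u using List.reverseRecOn with
    | nil => simp
    | append_singleton u n ih =>
      intro hu
      rw [code_append_of_not_isSplitting (hns u n hu)]
      exact ih ((List.prefix_append _ _).trans hu)
  have hsp : ∀ t ∈ T, s <+: t → IsSplitting T t := fun t ht hst =>
    ⟨ht, (hω t ht hst).2.nontrivial⟩
  obtain ⟨R, hR, hsplit, h⟩ := exists_homogeneous_subtree hA (T := T)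
    (fun t ht => (hcomp t ht).elim (fun h => ⟨s, h, hsp s hs List.prefix_rfl⟩)
      fun h => ⟨t, List.prefix_rfl, hsp t ht h⟩)
    (fun t ht htsp => (hcomp t ht).elim (fun h => by
        obtain ⟨_ | ⟨n, w⟩, rfl⟩ := h
        · exact hω t ht (by simp)
        · exact (hns t n ⟨w, by simp⟩ htsp).elim)
      fun h => hω t ht h)
  refine ⟨⟨subtree T R, s, ⟨hs, ?_⟩, fun t ht => hcomp t ht.1, fun t ht hst =>
    hsplit t ht (hsp t ht.1 hst)⟩, subtree_le _ _, h⟩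
  rw [hcode s List.prefix_rfl]
  exact hR

end TreeForcing

theorem mainTheorem1 (A : Set (ℕ → ℕ)) (hA : MeasureTheory.AnalyticSet A) :
    TreeForcing.IsMeasurableFor TreeForcing.Sacks (fun p => TreeForcing.branches p.1) A ∧
    TreeForcing.IsMeasurableFor TreeForcing.Miller (fun p => TreeForcing.branches p.1) A ∧
    TreeForcing.IsMeasurableFor TreeForcing.Matet (fun p => p.body) A ∧
    TreeForcing.IsMeasurableFor TreeForcing.PrikrySilver (fun p => TreeForcing.branches p.1) A ∧
    TreeForcing.IsMeasurableFor TreeForcing.Willowtree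
      (fun p => TreeForcing.branches p.tree) A ∧
    TreeForcing.IsMeasurableFor TreeForcing.Laver (fun p => TreeForcing.branches p.1) A :=
  ⟨TreeForcing.isMeasurableFor_sacks hA, TreeForcing.isMeasurableFor_miller hA,
    TreeForcing.isMeasurableFor_matet hA, TreeForcing.isMeasurableFor_prikrySilver hA,
    TreeForcing.isMeasurableFor_willowtree hA, TreeForcing.isMeasurableFor_laver hA⟩
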